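/- Let $k$ be a positive integer and let $X$ be a finite set. The symmetric inverse monoid $\mathrm{SIM}(X)$ is the monoid of all partial one-to-one maps from $X$ to itself under composition, and $r_k(\sigma)$ denotes the number of $\alpha\in\mathrm{SIM}(X)$ with $\alpha^k=\sigma$. The path $[a_1a_2\cdots a_\ell]$ of length $\ell$, with distinct digits $a_1,\dots,a_\ell\in X$, sends $a_i$ to $a_{i+1}$ for $i<\ell$, is undefined at $a_\ell$, and fixes all other elements of $X$; paths are disjoint if they have no digit in common. For an integer partition $\lambda$ (with positive parts; the empty partition is the partition of $0$), let $\ell(\lambda)$ be the number of its parts, $\sum\lambda$ their sum, $\max\lambda$ its largest part ($0$ if $\lambda$ is empty), and $\mathrm{freq}(a,\lambda)$ the number of times $a$ occurs as a part; a product over $a\in\lambda$ is over the distinct parts. Let $m\ge 2$, let $n_1,\dots,n_m$ be non-negative integers, $n=n_1+\cdots+n_m$, and let $$\sigma=\sigma_{11}\cdots\sigma_{1n_1}\,\sigma_{21}\cdots\sigma_{2n_2}\cdots\sigma_{m1}\cdots\sigma_{mn_m}\in\mathrm{SIM}(X),$$ where the $\sigma_{ij}$ are pairwise disjoint paths, every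 element of $X$ is a digit of one of them, every $\sigma_{ij}$ has length at least $2$, and there is an $L$ such that the length of $\sigma_{ij}$ is $L-(i-1)$ for all $i,j$. If $k\nmid n$, then $r_k(\sigma)=0$. If $k\mid n$, then $$r_k(\sigma)=\sum_{\lambda_1,\dots,\lambda_{m-1}}\frac{n_1!\cdots n_m!}{\bigl(n/k-\sum_{i=1}^{m-1}\ell(\lambda_i)\bigr)!\,\prod_{i=1}^{m-1}\prod_{a\in\lambda_i}\mathrm{freq}(a,\lambda_i)!},$$ where the sum is over all tuples $(\lambda_1,\dots,\lambda_{m-1})$ of integer partitions such that, for every $i=1,\dots,m-1$, $\lambda_i$ is a partition of $\sum_{j=1}^{i}n_j-k\sum_{j=1}^{i-1}\ell(\lambda_j)$, $\max\lambda_i\le k$, and $\ell(\lambda_i)\le\bigl(n_{i+1}+\sum\lambda_i\bigr)/k$. Some of the $\lambda_i$ may be partitions of $0$. -/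

import Mathlib

/-- The symmetric inverse monoid on `X`: all partial one-to-one mappings from `X` to itself. -/
abbrev SIM (X : Type*) := X ≃. X

/-- Multiplication in `SIM X` is composition of partial maps (the right factor acts first). -/
instance SIM.instMonoid (X : Type*) : Monoid (SIM X) where
  mul f g := PEquiv.trans g f
  one := PEquiv.refl X
  mul_assoc f g h := (PEquiv.trans_assoc h g f).symm
  one_mul f := PEquiv.trans_refl f
  mul_one f := PEquiv.refl_trans f

/-- The number `r_k(σ)` of `k`-th roots of `σ` in `SIM X`. -/
noncomputable def SIM.rootCount {X : Type*} (k : ℕ) (σ : SIM X) : ℕ :=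
  Nat.card {α : SIM X // α ^ k = σ}

open Classical in
/-- The underlying partial map of the path `[a₁ a₂ ⋯ a_ℓ]`: `a_i ↦ a_{i+1}` for `i < ℓ`,
`a_ℓ ↦` nothing, and every element which is not a digit of the path is fixed. -/
noncomputable def SIM.pathFun {X : Type*} (l : List X) (x : X) : Option X :=
  if x ∈ l then l[l.idxOf x + 1]? else some x

theorem SIM.mem_pathFun {X : Type*} {l : List X} (hl : l.Nodup) (x y : X) :
    y ∈ SIM.pathFun l x ↔
      (∃ t : ℕ, l[t]? = some x ∧ l[t + 1]? = some y) ∨ (x ∉ l ∧ x = y) := by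
  classical
  unfold SIM.pathFun
  by_cases hx : x ∈ l
  · simp only [hx, if_true, not_true_eq_false, false_and, or_false, Option.mem_def]
    constructor
    · intro h
      refine ⟨_, ?_, h⟩
      convert List.getElem?_eq_getElem (List.idxOf_lt_length_iff.2 hx) using 1
      simp
    · rintro ⟨t, h1, h2⟩
      obtain ⟨ht, rfl⟩ := List.getElem?_eq_some_iff.1 h1
      convert h2 using 2
      convert congrArg (· + 1) (hl.idxOf_getElem t ht)
  · simp only [hx, if_false, not_false_eq_true, true_and, Option.mem_def, Option.some.injEq]
    constructor
    · exact Or.inr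
    · rintro (⟨t, h1, -⟩ | h)
      · exact absurd (List.mem_of_getElem? h1) hx
      · exact h

/-- The path `[a₁ a₂ ⋯ a_ℓ]` on a list of distinct digits, as an element of `SIM X`.
Its inverse is the path `[a_ℓ ⋯ a₂ a₁]`. -/
noncomputable def SIM.path {X : Type*} (l : List X) (hl : l.Nodup) : SIM X where
  toFun := SIM.pathFun l
  invFun := SIM.pathFun l.reverse
  inv x y := by
    have hrev := List.length_reverse (as := l)
    refine Iff.symm ?_
    rw [← Option.mem_def, ← Option.mem_def, SIM.mem_pathFun hl,
      SIM.mem_pathFun (List.nodup_reverse.2 hl), List.mem_reverse]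
    constructor
    · rintro (⟨t, h1, h2⟩ | ⟨h, rfl⟩)
      · obtain ⟨ht1, h1⟩ := List.getElem?_eq_some_iff.1 h1
        obtain ⟨ht2, h2⟩ := List.getElem?_eq_some_iff.1 h2
        refine Or.inl ⟨l.length - 2 - t, ?_, ?_⟩
        · rw [List.getElem?_eq_some_iff]
          refine ⟨by omega, ?_⟩
          rw [← h2, List.getElem_reverse]
          congr 1
          omega
        · rw [List.getElem?_eq_some_iff]
          refine ⟨by omega, ?_⟩
          rw [← h1, List.getElem_reverse]
          congr 1
          omega
      · exact Or.inr ⟨h, rfl⟩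
    · rintro (⟨t, h1, h2⟩ | ⟨h, rfl⟩)
      · obtain ⟨ht1, h1⟩ := List.getElem?_eq_some_iff.1 h1
        obtain ⟨ht2, h2⟩ := List.getElem?_eq_some_iff.1 h2
        refine Or.inl ⟨l.length - 2 - t, ?_, ?_⟩
        · rw [List.getElem?_eq_some_iff]
          refine ⟨by omega, ?_⟩
          rw [← h2, List.getElem_reverse]
          congr 1
          omega
        · rw [List.getElem?_eq_some_iff]
          refine ⟨by omega, ?_⟩
          rw [← h1, List.getElem_reverse]
          congr 1
          omega
      · exact Or.inr ⟨h, rfl⟩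

/-- An integer partition of an arbitrary natural number (zero included). -/
abbrev IntPartition := Σ N : ℕ, Nat.Partition N

/-- The number `∑ λ` of which `λ` is a partition. -/
def IntPartition.size (p : IntPartition) : ℕ := p.1

/-- The length `ℓ(λ)`, the number of parts. -/
def IntPartition.length (p : IntPartition) : ℕ := p.2.parts.card

/-- `freq(a, λ)`, the number of times `a` occurs as a part. -/
def IntPartition.freq (a : ℕ) (p : IntPartition) : ℕ := p.2.parts.count a

/-- `∏_{a ∈ λ} freq(a, λ)!`, the product being over the distinct parts of `λ`. -/
def IntPartition.freqProd (p : IntPartition) : ℕ :=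
  ∏ a ∈ p.2.parts.toFinset, (p.freq a).factorial

/-- The condition on a chain of partitions `λ_1, …, λ_r` for the multiplicities
`n_1, …, n_{r+1}` (both indexed from `0` here, so that `i.castSucc` is the position of `n_i` and
`i.succ` the position of `n_{i+1}`):
`λ_i ⊢ (n_1 + ⋯ + n_i) - k (ℓ(λ_1) + ⋯ + ℓ(λ_{i-1}))`, `max λ_i ≤ k` and
`ℓ(λ_i) ≤ (n_{i+1} + ∑ λ_i) / k`. -/
def IsRootChain {r : ℕ} (k : ℕ) (n : Fin (r + 1) → ℕ) (lam : Fin r → IntPartition) : Prop :=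
  ∀ i : Fin r,
    (((lam i).size : ℤ) =
      ∑ j ∈ Finset.Iic i.castSucc, (n j : ℤ) - k * ∑ j ∈ Finset.Iio i, ((lam j).length : ℤ)) ∧
    (∀ a ∈ (lam i).2.parts, a ≤ k) ∧
    ((lam i).length : ℚ) ≤ ((n i.succ : ℚ) + (lam i).size) / k

open Classical in
/-- The finite set of all chains satisfying `IsRootChain`. The bound on the sizes used to build it
is no restriction, see `mem_rootChains`. -/
noncomputable def rootChains {r : ℕ} (k : ℕ) (n : Fin (r + 1) → ℕ) :
    Finset (Fin r → IntPartition) :=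
  (Fintype.piFinset fun _ : Fin r =>
    (Finset.range (∑ j, n j + 1)).sigma fun N => (Finset.univ : Finset (Nat.Partition N))).filter
      (IsRootChain k n)

theorem mem_rootChains {r : ℕ} (k : ℕ) (n : Fin (r + 1) → ℕ) (lam : Fin r → IntPartition) :
    lam ∈ rootChains k n ↔ IsRootChain k n lam := by
  classical
  simp only [rootChains, Finset.mem_filter, Fintype.mem_piFinset, Finset.mem_sigma,
    Finset.mem_range, Finset.mem_univ, and_true, and_iff_right_iff_imp]
  intro h i
  have h1 := (h i).1
  have h2 : ∑ j ∈ Finset.Iic i.castSucc, (n j : ℤ) ≤ ∑ j, (n j : ℤ) :=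
    Finset.sum_le_sum_of_subset_of_nonneg (Finset.subset_univ _) fun _ _ _ => by positivity
  have h3 : (0 : ℤ) ≤ k * ∑ j ∈ Finset.Iio i, ((lam j).length : ℤ) := by positivity
  have h4 : ((lam i).size : ℤ) ≤ ((∑ j, n j : ℕ) : ℤ) := by push_cast; linarith
  exact Nat.lt_succ_of_le (by exact_mod_cast h4)

theorem exists_equiv_comp_eq {A B C : Type*} [Finite A] [Finite B] (c : B → C) (w : A → C)
    (h : ∀ i, Nat.card {a // w a = i} = Nat.card {b // c b = i}) :
    ∃ e : A ≃ B, ∀ a, c (e a) = w a := by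
  have f : ∀ i, {a // w a = i} ≃ {b // c b = i} := fun i => (Finite.card_eq.1 (h i)).some
  exact ⟨Equiv.ofFiberEquiv f, fun a => Equiv.ofFiberEquiv_map f a⟩

theorem card_equiv_comp_eq {A B C : Type*} [Finite A] [Finite B] [Fintype C]
    (c : B → C) (w : A → C)
    (h : ∀ i, Nat.card {a // w a = i} = Nat.card {b // c b = i}) :
    Nat.card {e : A ≃ B // ∀ a, c (e a) = w a} = ∏ i, (Nat.card {b // c b = i}).factorial := by
  classical
  have := Fintype.ofFinite A
  obtain ⟨e₀, he₀⟩ := exists_equiv_comp_eq c w h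
  have E : {e : A ≃ B // ∀ a, c (e a) = w a} ≃ {g : Equiv.Perm A // w ∘ g = w} :=
    Equiv.subtypeEquiv (Equiv.equivCongr (Equiv.refl A) e₀.symm) fun e => by
      rw [funext_iff]
      refine forall_congr' fun a => ?_
      simp [← he₀]
  rw [Nat.card_congr E, Nat.card_eq_fintype_card, DomMulAct.stabilizer_card]
  refine Finset.prod_congr rfl fun i _ => ?_
  rw [← h, Nat.card_eq_fintype_card]

/-- Bijections onto a coloured set whose pulled back colouring satisfies `Q`. -/
theorem card_equiv_subtype_comp {A B C : Type*} [Finite A] [Finite B] [Fintype C]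
    (c : B → C) (Q : (A → C) → Prop) :
    Nat.card {e : A ≃ B // Q fun a => c (e a)} =
      Nat.card {w : A → C // Q w ∧ ∀ i, Nat.card {a // w a = i} = Nat.card {b // c b = i}} *
        ∏ i, (Nat.card {b // c b = i}).factorial := by
  classical
  let W := {w : A → C // Q w ∧ ∀ i, Nat.card {a // w a = i} = Nat.card {b // c b = i}}
  let F : {e : A ≃ B // Q fun a => c (e a)} → W := fun e =>
    ⟨fun a => c (e.1 a), e.2, fun i => Nat.card_congr (e.1.subtypeEquiv fun a => Iff.rfl)⟩
  have := Fintype.ofFinite W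
  rw [Nat.card_congr (Equiv.sigmaFiberEquiv F).symm, Nat.card_sigma]
  have hF : ∀ w : W, Nat.card {e // F e = w} = ∏ i, (Nat.card {b // c b = i}).factorial := by
    intro w
    rw [← card_equiv_comp_eq c w.1 w.2.2]
    refine Nat.card_congr ⟨fun e => ⟨e.1.1, fun a => congrFun (congrArg Subtype.val e.2) a⟩,
      fun e => ⟨⟨e.1, ?_⟩, ?_⟩, fun _ => rfl, fun _ => rfl⟩
    · rw [funext e.2]; exact w.2.1
    · exact Subtype.ext (funext e.2)
  rw [Finset.sum_congr rfl fun w _ => hF w, Finset.sum_const, Finset.card_univ, smul_eq_mul,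
    Nat.card_eq_fintype_card]

/-- The number of words with prescribed letter counts is a multinomial coefficient. -/
theorem card_words_mul_prod_factorial {C : Type*} [Fintype C] (M : ℕ) (f : C → ℕ)
    (hf : ∑ i, f i = M) :
    Nat.card {w : Fin M → C // ∀ i, Nat.card {a // w a = i} = f i} * ∏ i, (f i).factorial =
      M.factorial := by
  classical
  have h1 : ∀ i, Nat.card {b : Σ i, Fin (f i) // b.1 = i} = f i := fun i => by
    rw [Nat.card_congr (Equiv.sigmaSubtype i), Nat.card_fin]
  have := card_equiv_subtype_comp (A := Fin M) (fun b : Σ i, Fin (f i) => b.1) fun _ => True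
  simp only [h1, true_and] at this
  rw [← this, Nat.card_congr (Equiv.subtypeUnivEquiv fun _ => trivial), Nat.card_eq_fintype_card,
    Fintype.card_equiv (Fintype.equivOfCardEq (by simp [hf])), Fintype.card_fin]

theorem SIM.mul_apply {X : Type*} (f g : SIM X) (x : X) : (f * g) x = (g x).bind f := rfl

theorem SIM.one_apply {X : Type*} (x : X) : (1 : SIM X) x = some x := rfl

theorem SIM.prod_ofFn_fix {X : Type*} {n : ℕ} (f : Fin n → SIM X) {x : X}
    (h : ∀ j, f j x = some x) : (List.ofFn f).prod x = some x := by
  induction n with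
  | zero => rfl
  | succ n ih =>
    rw [List.ofFn_succ, List.prod_cons, SIM.mul_apply, ih _ fun j => h j.succ]
    exact h 0

theorem SIM.prod_ofFn_single {X : Type*} {n : ℕ} (f : Fin n → SIM X) (j : Fin n) (U : Set X)
    (hU : ∀ x ∈ U, ∀ y ∈ f j x, y ∈ U) (h : ∀ j', j' ≠ j → ∀ x ∈ U, f j' x = some x)
    {x : X} (hx : x ∈ U) : (List.ofFn f).prod x = f j x := by
  induction n with
  | zero => exact j.elim0
  | succ n ih =>
    rw [List.ofFn_succ, List.prod_cons, SIM.mul_apply]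
    induction j using Fin.cases with
    | zero =>
      rw [SIM.prod_ofFn_fix _ fun j => h j.succ (Fin.succ_ne_zero j) x hx]
      rfl
    | succ j =>
      rw [ih (fun j => f j.succ) j hU fun j' hj' => h j'.succ (by simpa using hj')]
      cases hy : f j.succ x with
      | none => rfl
      | some y => exact h 0 (Fin.succ_ne_zero j).symm y (hU x hx y hy)

theorem SIM.path_apply_of_notMem {X : Type*} {l : List X} (hl : l.Nodup) {x : X} (hx : x ∉ l) :
    SIM.path l hl x = some x := if_neg hx

theorem SIM.path_apply_of_getElem? {X : Type*} {l : List X} (hl : l.Nodup) {x : X} {t : ℕ}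
    (hx : l[t]? = some x) : SIM.path l hl x = l[t + 1]? := by
  refine Option.ext fun y => ?_
  change y ∈ SIM.pathFun l x ↔ _
  rw [SIM.mem_pathFun hl]
  constructor
  · rintro (⟨u, h1, h2⟩ | ⟨h, -⟩)
    · obtain ⟨ht, h3⟩ := List.getElem?_eq_some_iff.1 hx
      obtain ⟨hu, h4⟩ := List.getElem?_eq_some_iff.1 h1
      rwa [(hl.getElem_inj_iff (hi := ht) (hj := hu)).1 (h3.trans h4.symm)]
    · exact absurd (List.mem_of_getElem? hx) h
  · exact fun h => Or.inl ⟨t, hx, h⟩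

theorem SIM.mem_of_mem_path {X : Type*} {l : List X} (hl : l.Nodup) {x y : X} (hx : x ∈ l)
    (h : y ∈ SIM.path l hl x) : y ∈ l := by
  obtain ⟨t, ht⟩ := List.mem_iff_getElem?.1 hx
  rw [SIM.path_apply_of_getElem? hl ht] at h
  exact List.mem_of_getElem? h

theorem SIM.prod_paths_apply {X : Type*} {m : ℕ} {n : Fin m → ℕ}
    (d : (i : Fin m) → Fin (n i) → List X) (hnodup : ∀ i j, (d i j).Nodup)
    (hdisj : ∀ i j i' j', (⟨i, j⟩ : Σ i, Fin (n i)) ≠ ⟨i', j'⟩ → (d i j).Disjoint (d i' j'))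
    {i : Fin m} {j : Fin (n i)} {t : ℕ} {x : X} (hx : (d i j)[t]? = some x) :
    (List.ofFn fun i => (List.ofFn fun j => SIM.path (d i j) (hnodup i j)).prod).prod x =
      (d i j)[t + 1]? := by
  have hin : ∀ x ∈ d i j, (List.ofFn fun j => SIM.path (d i j) (hnodup i j)).prod x =
      SIM.path (d i j) (hnodup i j) x := fun x hx => by
    refine SIM.prod_ofFn_single _ j {x | x ∈ d i j} (fun x hx y => SIM.mem_of_mem_path _ hx)
      (fun j' hj' x hx => SIM.path_apply_of_notMem _ fun h => ?_) hx
    exact hdisj i j' i j (by simpa using hj') h hx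
  have hmem := List.mem_of_getElem? hx
  rw [SIM.prod_ofFn_single _ i {x | x ∈ d i j} (fun x hx y hy => ?_) (fun i' hi' x hx => ?_) hmem,
    hin x hmem, SIM.path_apply_of_getElem? _ hx]
  · rw [hin x hx] at hy
    exact SIM.mem_of_mem_path _ hx hy
  · refine SIM.prod_ofFn_fix _ fun j' => SIM.path_apply_of_notMem _ fun h => ?_
    exact hdisj i' j' i j (fun h => hi' (congrArg Sigma.fst h)) h hx

/-- A decomposition of `X` into sequences `pt i 0, pt i 1, …`, each of which stops at some point
or goes on forever. -/
structure PathSystem {I X : Type*} (pt : I → ℕ → Option X) : Prop where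
  inj : ∀ {i j t u x}, pt i t = some x → pt j u = some x → i = j ∧ t = u
  surj : ∀ x, ∃ i t, pt i t = some x
  down : ∀ {i t}, pt i t = none → pt i (t + 1) = none

namespace SIM

/-- `α` moves each point one step ahead along the sequences `pt i`. -/
def Follows {I X : Type*} (α : SIM X) (pt : I → ℕ → Option X) : Prop :=
  ∀ i t x, pt i t = some x → α x = pt i (t + 1)

/-- The points at which no image under `α` arrives. -/
def initial {X : Type*} (α : SIM X) : Set X := {x | ∀ y, α y ≠ some x}

end SIM

namespace PathSystem

open SIM

variable {I X : Type*} {pt : I → ℕ → Option X}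

theorem none_of_le (h : PathSystem pt) {i : I} {t u : ℕ} (htu : t ≤ u) (ht : pt i t = none) :
    pt i u = none := by
  induction htu with
  | refl => exact ht
  | step _ ih => exact h.down ih

theorem follows_unique (h : PathSystem pt) {α β : SIM X} (hα : Follows α pt)
    (hβ : Follows β pt) : α = β := by
  ext1 x
  obtain ⟨i, t, hx⟩ := h.surj x
  rw [hα i t x hx, hβ i t x hx]

theorem pow_apply (h : PathSystem pt) {α : SIM X} (hα : Follows α pt) {i : I} {t : ℕ} {x : X}
    (hx : pt i t = some x) (j : ℕ) : (α ^ j) x = pt i (t + j) := by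
  induction j with
  | zero => rw [pow_zero, SIM.one_apply, add_zero, hx]
  | succ j ih =>
    rw [pow_succ', SIM.mul_apply, ih, ← add_assoc]
    cases hy : pt i (t + j) with
    | none => exact (h.down hy).symm
    | some y => exact hα i _ y hy

theorem exists_follows (h : PathSystem pt) : ∃ α : SIM X, Follows α pt := by
  choose a b hab using h.surj
  refine ⟨⟨fun x => pt (a x) (b x + 1), fun y => if b y = 0 then none else pt (a y) (b y - 1),
    fun x y => ?_⟩, fun i t x hx => ?_⟩
  · constructor
    · intro hy
      have hy : (if b y = 0 then none else pt (a y) (b y - 1)) = some x := hy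
      split_ifs at hy with h0
      obtain ⟨h1, h2⟩ := h.inj hy (hab x)
      rw [← h1, ← h2, Nat.sub_add_cancel (Nat.pos_of_ne_zero h0)]
      exact hab y
    · intro hx
      obtain ⟨h1, h2⟩ := h.inj hx (hab y)
      have h0 : b y ≠ 0 := by omega
      change (if b y = 0 then none else pt (a y) (b y - 1)) = some x
      rw [if_neg h0, ← h1, ← h2]
      exact hab x
  · obtain ⟨h1, h2⟩ := h.inj hx (hab x)
    rw [h1, h2]
    rfl

theorem mem_initial_iff (h : PathSystem pt) {α : SIM X} (hα : Follows α pt) {i : I} {t : ℕ} {x : X}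
    (hx : pt i t = some x) : x ∈ α.initial ↔ t = 0 := by
  constructor
  · intro hi
    by_contra h0
    obtain ⟨t, rfl⟩ := Nat.exists_eq_succ_of_ne_zero h0
    cases hy : pt i t with
    | none => rw [h.down hy] at hx; cases hx
    | some y => exact hi y ((hα i t y hy).trans hx)
  · rintro rfl y hy
    obtain ⟨j, u, hu⟩ := h.surj y
    rw [hα j u y hu] at hy
    exact absurd (h.inj hx hy).2.symm (Nat.succ_ne_zero u)

end PathSystem

namespace SIM

variable {X : Type*}

theorem eq_of_apply_eq (α : SIM X) {x y z : X} (hx : α x = some z) (hy : α y = some z) : x = y :=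
  PEquiv.inj α hx hy

theorem pow_add_apply (α : SIM X) (u v : ℕ) (x : X) :
    (α ^ (u + v)) x = ((α ^ u) x).bind (α ^ v) := by
  rw [add_comm, pow_add, mul_apply]

theorem pow_apply_eq_none (α : SIM X) {u v : ℕ} (h : u ≤ v) {x : X} (hx : (α ^ u) x = none) :
    (α ^ v) x = none := by
  obtain ⟨w, rfl⟩ := Nat.exists_eq_add_of_le h
  rw [pow_add_apply, hx]
  rfl

/-- Cancelling a common power in an equation between iterates. -/
theorem apply_pow_sub (α : SIM X) {u v : ℕ} (h : u ≤ v) {x y z : X} (hx : (α ^ u) x = some z)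
    (hy : (α ^ v) y = some z) : (α ^ (v - u)) y = some x := by
  obtain ⟨w, rfl⟩ := Nat.exists_eq_add_of_le h
  rw [add_comm, pow_add_apply] at hy
  rw [Nat.add_sub_cancel_left]
  cases hw : (α ^ w) y with
  | none => rw [hw] at hy; cases hy
  | some x' =>
    rw [hw] at hy
    rw [(α ^ u).eq_of_apply_eq hx hy]

theorem pow_apply_ne_of_mem_initial (α : SIM X) {x : X} (hx : x ∈ α.initial) {w : ℕ} (hw : w ≠ 0)
    (y : X) : (α ^ w) y ≠ some x := by
  obtain ⟨w, rfl⟩ := Nat.exists_eq_succ_of_ne_zero hw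
  intro h
  rw [pow_succ', mul_apply] at h
  cases hz : (α ^ w) y with
  | none => rw [hz] at h; cases h
  | some z => rw [hz] at h; exact hx z h

theorem initial_pow_unique (α : SIM X) {x x' z : X} (hx : x ∈ α.initial) (hx' : x' ∈ α.initial)
    {u v : ℕ} (h : (α ^ u) x = some z) (h' : (α ^ v) x' = some z) : x = x' ∧ u = v := by
  wlog huv : u ≤ v generalizing u v x x'
  · obtain ⟨h1, h2⟩ := this hx' hx h' h (le_of_not_ge huv)
    exact ⟨h1.symm, h2.symm⟩
  have h3 := α.apply_pow_sub huv h h'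
  have h4 : v - u = 0 := by
    by_contra h0
    exact α.pow_apply_ne_of_mem_initial hx h0 x' h3
  rw [h4, pow_zero, one_apply] at h3
  exact ⟨(Option.some.inj h3).symm, by omega⟩

/-- The iterates of `α` on an initial point, up to the exponent `k - 1`, are initial for `α ^ k`. -/
theorem mem_initial_pow (α : SIM X) {k j : ℕ} (hj : j < k) {x z : X} (hx : x ∈ α.initial)
    (h : (α ^ j) x = some z) : z ∈ (α ^ k).initial := fun y hy =>
  α.pow_apply_ne_of_mem_initial hx (by omega) y (α.apply_pow_sub hj.le h hy)

theorem initial_subset_initial_pow (α : SIM X) {k : ℕ} (hk : 0 < k) :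
    α.initial ⊆ (α ^ k).initial := fun x hx =>
  α.mem_initial_pow hk hx (by rw [pow_zero, one_apply])

theorem exists_initial_of_mem_initial_pow (α : SIM X) {k : ℕ} {z : X} (hz : z ∈ (α ^ k).initial) :
    ∃ j < k, ∃ x ∈ α.initial, (α ^ j) x = some z := by
  classical
  by_contra! hcon
  have key : ∀ j ≤ k, ∃ x, (α ^ j) x = some z := by
    intro j
    induction j with
    | zero => exact fun _ => ⟨z, by rw [pow_zero, one_apply]⟩
    | succ j ih =>
      intro hj
      obtain ⟨x, hx⟩ := ih (by omega)
      have hni : x ∉ α.initial := fun h => hcon j (by omega) x h hx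
      simp only [initial, Set.mem_ofPred_eq, not_forall, not_not] at hni
      obtain ⟨y, hy⟩ := hni
      refine ⟨y, ?_⟩
      rw [pow_succ, mul_apply, hy]
      exact hx
  obtain ⟨x, hx⟩ := key k le_rfl
  exact hz x hx

end SIM

/-- The classes of the `k` paths joined by a `k`-th root to a single path: they are monotone, and
any two of them differ by at most `1`. -/
def IsRow {k s : ℕ} (w : Fin k → Fin s) : Prop :=
  Monotone w ∧ ∀ j j', (w j' : ℕ) ≤ w j + 1

/-- Interlacing of the `k` sequences `e (a, 0), …, e (a, k - 1)` to a single one. -/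
def interlace {A P X : Type*} {k : ℕ} [NeZero k] (pt : P → ℕ → Option X) (e : A × Fin k ≃ P)
    (a : A) (u : ℕ) : Option X :=
  pt (e (a, Fin.ofNat k u)) (u / k)

section

open SIM

variable {A P X : Type*} {k s L : ℕ} [NeZero k] {pt : P → ℕ → Option X} {len : P → ℕ}
  {c : P → Fin s} {σ : SIM X}

theorem interlace_add (e : A × Fin k ≃ P) (a : A) (j : Fin k) (t : ℕ) :
    interlace pt e a (k * t + j) = pt (e (a, j)) t := by
  have hk := NeZero.pos k
  have h1 : (k * t + j) / k = t := by
    rw [Nat.mul_add_div hk, Nat.div_eq_of_lt j.2, add_zero]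
  have h2 : Fin.ofNat k (k * t + j) = j := by
    ext
    simp [Fin.ofNat, Nat.mod_eq_of_lt j.2]
  rw [interlace, h1, h2]

theorem interlace_val (e : A × Fin k ≃ P) (a : A) (j : Fin k) :
    interlace pt e a j = pt (e (a, j)) 0 := by
  simpa using interlace_add (pt := pt) e a j 0

theorem exists_eq_mul_add (k : ℕ) [NeZero k] (u : ℕ) : ∃ (j : Fin k) (t : ℕ), u = k * t + j :=
  ⟨⟨u % k, Nat.mod_lt _ (NeZero.pos k)⟩, u / k, (Nat.div_add_mod u k).symm⟩

theorem interlace_add_self (e : A × Fin k ≃ P) (a : A) (u : ℕ) :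
    interlace pt e a (u + k) = pt (e (a, Fin.ofNat k u)) (u / k + 1) := by
  obtain ⟨j, t, rfl⟩ := exists_eq_mul_add k u
  have h1 : (k * t + j) / k = t := by
    rw [Nat.mul_add_div (NeZero.pos k), Nat.div_eq_of_lt j.2, add_zero]
  have h2 : Fin.ofNat k (k * t + j) = j := by
    ext
    simp [Fin.ofNat, Nat.mod_eq_of_lt j.2]
  rw [h1, h2, ← interlace_add (pt := pt)]
  congr 1
  ring

theorem pathSystem_interlace (h : PathSystem pt) (hlen : ∀ p t, pt p t = none ↔ len p ≤ t)
    (hc : ∀ p, len p + c p = L) (e : A × Fin k ≃ P)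
    (he : ∀ a, IsRow fun j => c (e (a, j))) : PathSystem (interlace pt e) where
  inj {a b u v x} hu hv := by
    obtain ⟨j, t, rfl⟩ := exists_eq_mul_add k u
    obtain ⟨j', t', rfl⟩ := exists_eq_mul_add k v
    rw [interlace_add] at hu hv
    obtain ⟨h1, rfl⟩ := h.inj hu hv
    obtain ⟨rfl, rfl⟩ := Prod.ext_iff.1 (e.injective h1)
    exact ⟨rfl, rfl⟩
  surj x := by
    obtain ⟨p, t, hp⟩ := h.surj x
    refine ⟨(e.symm p).1, k * t + (e.symm p).2, ?_⟩
    rw [interlace_add]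
    simpa using hp
  down {a u} hu := by
    obtain ⟨j, t, rfl⟩ := exists_eq_mul_add k u
    rw [interlace_add, hlen] at hu
    by_cases hj : (j : ℕ) + 1 < k
    · rw [show k * t + j + 1 = k * t + ((⟨j + 1, hj⟩ : Fin k) : ℕ) from rfl, interlace_add, hlen]
      have h1 : (c (e (a, j)) : ℕ) ≤ c (e (a, ⟨j + 1, hj⟩)) :=
        (he a).1 (show j ≤ ⟨j + 1, hj⟩ from Nat.le_succ _)
      have h2 := hc (e (a, j))
      have h3 := hc (e (a, ⟨j + 1, hj⟩))
      omega
    · rw [show k * t + j + 1 = k * (t + 1) + ((0 : Fin k) : ℕ) by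
        have := j.2
        rw [Fin.val_zero, mul_add]; omega, interlace_add, hlen]
      have h1 := (he a).2 0 j
      have h2 := hc (e (a, j))
      have h3 := hc (e (a, 0))
      simp only at h1
      omega

theorem pow_eq_of_follows_interlace (hσ : Follows σ pt)
    {e : A × Fin k ≃ P} (he : PathSystem (interlace pt e)) {α : SIM X}
    (hα : Follows α (interlace pt e)) : α ^ k = σ := by
  ext1 x
  obtain ⟨a, u, hx⟩ := he.surj x
  rw [he.pow_apply hα hx, hσ _ _ _ hx, interlace_add_self]

theorem isRow_of_pathSystem_interlace (hlen : ∀ p t, pt p t = none ↔ len p ≤ t)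
    (hc : ∀ p, len p + c p = L)
    {e : A × Fin k ≃ P} (he : PathSystem (interlace pt e)) (a : A) :
    IsRow fun j => c (e (a, j)) := by
  have key : ∀ (j j' : Fin k) t t', k * t + j ≤ k * t' + j' → len (e (a, j)) ≤ t →
      len (e (a, j')) ≤ t' := fun j j' t t' hle h0 => by
    rw [← hlen, ← interlace_add (pt := pt)] at h0 ⊢
    exact he.none_of_le hle h0
  constructor
  · intro j j' hj
    have h1 := key j j' _ _ (Nat.add_le_add_left hj _) le_rfl
    have h2 := hc (e (a, j))
    have h3 := hc (e (a, j'))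
    exact Fin.le_def.2 (show (c (e (a, j)) : ℕ) ≤ c (e (a, j')) by omega)
  · intro j j'
    have h1 := key j' j (len (e (a, j'))) (len (e (a, j')) + 1)
      (by have := j'.2; rw [mul_add]; omega) le_rfl
    have h2 := hc (e (a, j))
    have h3 := hc (e (a, j'))
    change (c (e (a, j')) : ℕ) ≤ c (e (a, j)) + 1
    omega

theorem exists_start (hlen : ∀ p t, pt p t = none ↔ len p ≤ t) (htwo : ∀ p, 2 ≤ len p) (p : P) :
    ∃ x, pt p 0 = some x :=
  Option.ne_none_iff_exists'.1 fun h0 => by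
    have := (hlen p 0).1 h0
    have := htwo p
    omega

/-- The paths of `α ^ k` are arranged into rows by the paths of `α`. -/
theorem exists_equiv_interlace_eq (h : PathSystem pt) (hlen : ∀ p t, pt p t = none ↔ len p ≤ t)
    (htwo : ∀ p, 2 ≤ len p) {α : SIM X} (hσ : Follows (α ^ k) pt) {b : A → X}
    (hb : Function.Injective b) (hb' : Set.range b = α.initial) :
    ∃ e : A × Fin k ≃ P, ∀ a u, interlace pt e a u = (α ^ u) (b a) := by
  choose st hst using exists_start hlen htwo
  have hbi : ∀ a, b a ∈ α.initial := fun a => hb' ▸ Set.mem_range_self a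
  have hk := NeZero.pos k
  have hdef : ∀ a, ∃ y, (α ^ k) (b a) = some y := fun a => by
    obtain ⟨p, t, hp⟩ := h.surj (b a)
    obtain rfl := (h.mem_initial_iff hσ hp).1 (α.initial_subset_initial_pow hk (hbi a))
    rw [hσ _ _ _ hp]
    refine Option.ne_none_iff_exists'.1 fun h0 => ?_
    have := (hlen p _).1 h0
    have := htwo p
    omega
  have hex : ∀ q : A × Fin k, ∃ p, (α ^ (q.2 : ℕ)) (b q.1) = pt p 0 := fun q => by
    obtain ⟨a, j⟩ := q
    obtain ⟨y, hy⟩ := hdef a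
    cases hz : (α ^ (j : ℕ)) (b a) with
    | none => rw [α.pow_apply_eq_none j.2.le hz] at hy; cases hy
    | some z =>
      obtain ⟨p, t, hp⟩ := h.surj z
      obtain rfl := (h.mem_initial_iff hσ hp).1 (α.mem_initial_pow j.2 (hbi a) hz)
      exact ⟨p, hp.symm⟩
  choose f hf using hex
  have hfb : Function.Bijective f := by
    constructor
    · rintro ⟨a, j⟩ ⟨a', j'⟩ hff
      have h1 := (hf (a, j)).trans (hst _)
      have h2 := (hf (a', j')).trans (hst _)
      rw [hff] at h1
      obtain ⟨h3, h4⟩ := α.initial_pow_unique (hbi a) (hbi a') h1 h2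
      exact Prod.ext (hb h3) (Fin.ext h4)
    · intro p
      obtain ⟨j, hj, x, hx, hjx⟩ := α.exists_initial_of_mem_initial_pow
        ((h.mem_initial_iff hσ (hst p)).2 rfl)
      rw [← hb'] at hx
      obtain ⟨a, rfl⟩ := hx
      refine ⟨(a, ⟨j, hj⟩), ?_⟩
      have h1 := hf (a, ⟨j, hj⟩)
      rw [hst] at h1
      exact (h.inj (hst p) ((hst _).trans (h1.symm.trans hjx))).1.symm
  refine ⟨Equiv.ofBijective f hfb, fun a u => ?_⟩
  obtain ⟨j, t, rfl⟩ := exists_eq_mul_add k u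
  have h1 := hf (a, j)
  rw [hst] at h1
  rw [interlace_add, add_comm, pow_add_apply, h1, pow_mul, Option.bind_some,
    h.pow_apply hσ (hst _), zero_add]
  rfl

/-- A root of `σ` together with an enumeration of its initial points is the same thing as an
arrangement of the paths of `σ` into rows. -/
theorem card_rows_eq_card_labelled_roots (h : PathSystem pt) (hlen : ∀ p t, pt p t = none ↔ len p ≤ t)
    (hc : ∀ p, len p + c p = L) (htwo : ∀ p, 2 ≤ len p) (hσ : Follows σ pt) :
    Nat.card {e : A × Fin k ≃ P // ∀ a, IsRow fun j => c (e (a, j))} =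
      Nat.card (Σ α : {α : SIM X // α ^ k = σ},
        {b : A → X // Function.Injective b ∧ Set.range b = α.1.initial}) := by
  choose st hst using exists_start hlen htwo
  let E := {e : A × Fin k ≃ P // ∀ a, IsRow fun j => c (e (a, j))}
  have hps : ∀ e : E, PathSystem (interlace pt e.1) := fun e =>
    pathSystem_interlace h hlen hc e.1 e.2
  choose root hroot using fun e : E => (hps e).exists_follows
  have hi0 : ∀ (e : E) a, interlace pt e.1 a 0 = some (st (e.1 (a, 0))) := fun e a => by
    rw [← hst, ← interlace_val (pt := pt), Fin.val_zero]
  let F : E → (Σ α : {α : SIM X // α ^ k = σ},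
        {b : A → X // Function.Injective b ∧ Set.range b = α.1.initial}) := fun e =>
    ⟨⟨root e, pow_eq_of_follows_interlace hσ (hps e) (hroot e)⟩,
      ⟨fun a => st (e.1 (a, 0)), by
        refine ⟨fun a a' haa => ((hps e).inj (hi0 e a) ((hi0 e a').trans ?_)).1, ?_⟩
        · exact congrArg some haa.symm
        · ext x
          constructor
          · rintro ⟨a, rfl⟩
            exact ((hps e).mem_initial_iff (hroot e) (hi0 e a)).2 rfl
          · intro hx
            obtain ⟨a, u, hu⟩ := (hps e).surj x
            obtain rfl := ((hps e).mem_initial_iff (hroot e) hu).1 hx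
            exact ⟨a, Option.some.inj ((hi0 e a).symm.trans hu)⟩⟩⟩
  refine Nat.card_congr (Equiv.ofBijective F ⟨fun e e' hee => ?_, ?_⟩)
  · have h1 : root e = root e' := congrArg (fun z => z.1.1) hee
    have h2 : (fun a => st (e.1 (a, 0))) = fun a => st (e'.1 (a, 0)) :=
      congrArg (fun z => z.2.1) hee
    refine Subtype.ext (Equiv.ext fun ⟨a, j⟩ => ?_)
    have h3 := (hps e).pow_apply (hroot e) (hi0 e a) j
    have h4 := (hps e').pow_apply (hroot e') (hi0 e' a) j
    rw [h1, congrFun h2 a, h4, zero_add, interlace_val, interlace_val, hst] at h3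
    exact ((h.inj (hst _) h3.symm).1).symm
  · rintro ⟨⟨α, rfl⟩, ⟨b, hb, hb'⟩⟩
    have hbi : ∀ a, b a ∈ α.initial := fun a => hb' ▸ Set.mem_range_self a
    obtain ⟨e, hint⟩ := exists_equiv_interlace_eq h hlen htwo hσ hb hb'
    have hes : PathSystem (interlace pt e) := by
      refine ⟨fun {a a' u v x} hu hv => ?_, fun x => ?_, fun {a u} hu => ?_⟩
      · rw [hint] at hu hv
        obtain ⟨h1, h2⟩ := α.initial_pow_unique (hbi a) (hbi a') hu hv
        exact ⟨hb h1, h2⟩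
      · obtain ⟨p, t, hp⟩ := h.surj x
        obtain ⟨⟨a, j⟩, rfl⟩ := e.surjective p
        exact ⟨a, _, (interlace_add e a j t).trans hp⟩
      · rw [hint] at hu ⊢
        exact α.pow_apply_eq_none (Nat.le_succ u) hu
    have hfol : Follows α (interlace pt e) := fun a u x hx => by
      rw [hint] at hx ⊢
      rw [pow_add_apply, hx, pow_one, Option.bind_some]
    refine ⟨⟨e, isRow_of_pathSystem_interlace hlen hc hes⟩, ?_⟩
    have hr : root ⟨e, isRow_of_pathSystem_interlace hlen hc hes⟩ = α :=
      (hps _).follows_unique (hroot _) hfol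
    have hbe : (fun a => st (e (a, 0))) = b := funext fun a => by
      have h1 := hint a 0
      rw [pow_zero, one_apply, interlace, Nat.zero_div] at h1
      exact Option.some.inj ((hst _).symm.trans h1)
    refine Sigma.ext (Subtype.ext hr) ?_
    refine Subtype.heq_iff_coe_eq (fun b => ?_) |>.2 hbe
    change _ ∧ _ = (root _).initial ↔ _
    rw [hr]

theorem card_initial_mul (h : PathSystem pt) (hlen : ∀ p t, pt p t = none ↔ len p ≤ t)
    (htwo : ∀ p, 2 ≤ len p) {α : SIM X} (hσ : Follows (α ^ k) pt) :
    Nat.card α.initial * k = Nat.card P := by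
  obtain ⟨e, -⟩ := exists_equiv_interlace_eq (k := k) h hlen htwo hσ
    (b := ((↑) : α.initial → X)) Subtype.val_injective Subtype.range_coe
  rw [← Nat.card_congr e, Nat.card_prod, Nat.card_fin]

theorem dvd_of_root (h : PathSystem pt) (hlen : ∀ p t, pt p t = none ↔ len p ≤ t)
    (htwo : ∀ p, 2 ≤ len p) (hσ : Follows σ pt) (h0 : SIM.rootCount k σ ≠ 0) : k ∣ Nat.card P := by
  obtain ⟨⟨α, rfl⟩⟩ := (Nat.card_ne_zero.1 h0).1
  exact ⟨_, ((mul_comm _ _).trans (card_initial_mul h hlen htwo hσ)).symm⟩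

theorem rootCount_mul_factorial [Finite X] (h : PathSystem pt)
    (hlen : ∀ p t, pt p t = none ↔ len p ≤ t) (hc : ∀ p, len p + c p = L)
    (htwo : ∀ p, 2 ≤ len p) (hσ : Follows σ pt) {M : ℕ} (hM : Nat.card P = M * k) :
    SIM.rootCount k σ * M.factorial =
      Nat.card {e : Fin M × Fin k ≃ P // ∀ a, IsRow fun j => c (e (a, j))} := by
  classical
  have : Finite (SIM X) := Finite.of_injective (fun f x => f x) DFunLike.coe_injective
  have := Fintype.ofFinite {α : SIM X // α ^ k = σ}
  rw [card_rows_eq_card_labelled_roots h hlen hc htwo hσ, Nat.card_sigma, Finset.sum_congr rfl fun α _ => ?_,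
    Finset.sum_const, Finset.card_univ, smul_eq_mul, SIM.rootCount, Nat.card_eq_fintype_card]
  obtain ⟨α, rfl⟩ := α
  have hcard := card_initial_mul h hlen htwo hσ
  rw [hM] at hcard
  have hcard := Nat.eq_of_mul_eq_mul_right (NeZero.pos k) hcard
  have hE : {b : Fin M → X // Function.Injective b ∧ Set.range b = α.initial} ≃
      {e : Fin M ≃ α.initial // True} :=
    { toFun b := ⟨(Equiv.ofInjective b.1 b.2.1).trans (Equiv.setCongr b.2.2), trivial⟩
      invFun e := ⟨fun a => (e.1 a : X), Subtype.val_injective.comp e.1.injective, by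
        rw [show (fun a => (e.1 a : X)) = Subtype.val ∘ e.1 from rfl, Set.range_comp,
          e.1.range_eq_univ, Set.image_univ, Subtype.range_coe]⟩
      left_inv b := rfl
      right_inv e := Subtype.ext (Equiv.ext fun a => Subtype.ext rfl) }
  have e₁ : Fin M ≃ α.initial := Finite.card_eq.1 (by rw [Nat.card_fin, hcard]) |>.some
  have := Fintype.ofFinite α.initial
  rw [Nat.card_congr (hE.trans (Equiv.subtypeUnivEquiv fun _ => trivial)),
    Nat.card_eq_fintype_card, Fintype.card_equiv e₁, Fintype.card_fin]

end

theorem IntPartition.ext_parts {p q : IntPartition} (h : p.2.parts = q.2.parts) : p = q := by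
  obtain ⟨N, p⟩ := p
  obtain ⟨N', q⟩ := q
  have hN : N = N' := by rw [← p.parts_sum, ← q.parts_sum]; exact congrArg _ h
  subst hN
  exact congrArg (Sigma.mk N) (Nat.Partition.ext h)

theorem IntPartition.freq_eq_zero {p : IntPartition} {k : ℕ} (hp : ∀ a ∈ p.2.parts, a ≤ k) {a : ℕ}
    (ha : ∀ s : Fin k, a ≠ s + 1) : p.freq a = 0 := by
  refine Multiset.count_eq_zero.2 fun h => ?_
  have h1 := p.2.parts_pos h
  have h2 := hp a h
  exact ha ⟨a - 1, by omega⟩ (by simp only; omega)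

@[to_additive]
theorem IntPartition.prod_freq {N : Type*} [CommMonoid N] (φ : ℕ → N) (hφ : φ 0 = 1)
    {p : IntPartition} {k : ℕ} (hp : ∀ a ∈ p.2.parts, a ≤ k) :
    ∏ s : Fin k, φ (p.freq (s + 1)) = ∏ a ∈ p.2.parts.toFinset, φ (p.freq a) := by
  have hinj : Function.Injective fun s : Fin k => (s : ℕ) + 1 := fun s t h =>
    Fin.ext (Nat.succ.inj h)
  refine (Finset.prod_map Finset.univ ⟨fun s : Fin k => (s : ℕ) + 1, hinj⟩
    fun a => φ (p.freq a)).symm.trans (Eq.symm ?_)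
  refine Finset.prod_subset (fun a ha => ?_) fun a _ ha => ?_
  · by_contra hcon
    refine Multiset.count_ne_zero.2 (Multiset.mem_toFinset.1 ha)
      (IntPartition.freq_eq_zero hp fun s hs => hcon ?_)
    exact Finset.mem_map.2 ⟨s, Finset.mem_univ _, hs.symm⟩
  · rw [Multiset.mem_toFinset] at ha
    rw [IntPartition.freq, Multiset.count_eq_zero.2 ha, hφ]

theorem IntPartition.sum_freq_eq_length {p : IntPartition} {k : ℕ}
    (hp : ∀ a ∈ p.2.parts, a ≤ k) : ∑ s : Fin k, p.freq (s + 1) = p.length :=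
  (IntPartition.sum_freq id rfl hp).trans (Multiset.toFinset_sum_count_eq _)

theorem IntPartition.prod_factorial_freq {p : IntPartition} {k : ℕ}
    (hp : ∀ a ∈ p.2.parts, a ≤ k) :
    ∏ s : Fin k, (p.freq (s + 1)).factorial = p.freqProd :=
  IntPartition.prod_freq Nat.factorial rfl hp

/-- The row encoded by a letter: `some (i, s)` stands for `s + 1` entries `i` followed by entries
`i + 1`, and `none` for the constant row with the last possible entry. -/
def rowOf {r k : ℕ} : Option (Fin r × Fin k) → Fin k → Fin (r + 1)
  | none, _ => Fin.last r
  | some (i, s), j => if j ≤ s then i.castSucc else i.succ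

theorem rowOf_injective {r k : ℕ} [NeZero k] :
    Function.Injective (rowOf : Option (Fin r × Fin k) → Fin k → Fin (r + 1)) := by
  have h0 : ∀ (i : Fin r) (s : Fin k), rowOf (some (i, s)) (0 : Fin k) = i.castSucc := fun i s => by
    rw [rowOf, if_pos (Fin.zero_le s)]
  have key : ∀ (i : Fin r) (s s' : Fin k), s < s' → rowOf (some (i, s)) ≠ rowOf (some (i, s')) := by
    intro i s s' hs h
    have h1 : (if s' ≤ s then i.castSucc else i.succ) = if s' ≤ s' then i.castSucc else i.succ :=
      congrFun h s'
    rw [if_neg (not_le.2 hs), if_pos le_rfl] at h1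
    exact absurd h1 (Fin.castSucc_lt_succ (i := i)).ne'
  rintro (_ | ⟨i, s⟩) (_ | ⟨i', s'⟩) h
  · rfl
  · exact absurd ((h0 i' s').symm.trans (congrFun h 0).symm) (Fin.castSucc_lt_last i').ne
  · exact absurd ((h0 i s).symm.trans (congrFun h 0)) (Fin.castSucc_lt_last i).ne
  · obtain rfl := Fin.castSucc_injective _ ((h0 i s).symm.trans ((congrFun h 0).trans (h0 i' s')))
    rcases lt_trichotomy s s' with hs | rfl | hs
    · exact absurd h (key i s s' hs)
    · rfl
    · exact absurd h.symm (key i s' s hs)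

theorem isRow_rowOf {r k : ℕ} (τ : Option (Fin r × Fin k)) : IsRow (rowOf τ) := by
  rcases τ with _ | ⟨i, s⟩
  · exact ⟨fun _ _ _ => le_rfl, fun _ _ => Nat.le_succ _⟩
  · constructor
    · intro j j' hj
      simp only [rowOf]
      split_ifs with h1 h2 h2
      · exact le_rfl
      · exact Fin.castSucc_lt_succ.le
      · exact absurd (hj.trans h2) h1
      · exact le_rfl
    · intro j j'
      simp only [rowOf]
      split_ifs <;> simp only [Fin.val_castSucc, Fin.val_succ] <;> omega

theorem IsRow.exists_rowOf {r k : ℕ} [NeZero k] {w : Fin k → Fin (r + 1)} (hw : IsRow w) :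
    ∃ τ, rowOf τ = w := by
  have hw0 : ∀ j, (w 0 : ℕ) ≤ w j := fun j => hw.1 (Fin.zero_le j)
  by_cases h0 : w 0 = Fin.last r
  · refine ⟨none, funext fun j => ?_⟩
    have h1 := hw0 j
    rw [h0] at h1
    exact (Fin.last_le_iff.1 (Fin.le_def.2 h1)).symm
  · obtain ⟨i, hi⟩ := Fin.exists_castSucc_eq.2 h0
    have hne : (Finset.univ.filter fun j => w j = i.castSucc).Nonempty :=
      ⟨0, by simp [hi]⟩
    obtain ⟨s, hs, hmax⟩ := Finset.exists_max_image _ id hne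
    simp only [Finset.mem_filter, Finset.mem_univ, true_and, id_eq] at hs hmax
    refine ⟨some (i, s), funext fun j => ?_⟩
    simp only [rowOf]
    have h1 := hw0 j
    have h2 := hw.2 0 j
    rw [← hi, Fin.val_castSucc] at h1 h2
    split_ifs with hj
    · exact le_antisymm (Fin.le_def.2 h1) (hs ▸ hw.1 hj)
    · have h3 : w j ≠ i.castSucc := fun h => hj (hmax j h)
      rw [Ne, Fin.ext_iff, Fin.val_castSucc] at h3
      rw [Fin.ext_iff, Fin.val_succ]
      omega

/-- The contribution of a letter to the `i`-th partition of a chain. -/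
def letterPart {r k : ℕ} (i : Fin r) : Option (Fin r × Fin k) → Multiset ℕ
  | none => 0
  | some (i', s) => if i' = i then {(s : ℕ) + 1} else 0

theorem mem_letterPart {r k : ℕ} {i : Fin r} {τ : Option (Fin r × Fin k)} {a : ℕ} :
    a ∈ letterPart i τ ↔ ∃ s : Fin k, τ = some (i, s) ∧ a = s + 1 := by
  rcases τ with _ | ⟨i', s⟩
  · simp [letterPart]
  · simp only [letterPart]
    split_ifs with h
    · subst h; simp
    · simp [h]

theorem count_letterPart {r k : ℕ} (i : Fin r) (s : Fin k) (τ : Option (Fin r × Fin k)) :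
    (letterPart i τ).count ((s : ℕ) + 1) = if τ = some (i, s) then 1 else 0 := by
  rcases τ with _ | ⟨i', s'⟩
  · simp [letterPart]
  · simp only [letterPart, Option.some.injEq, Prod.mk.injEq]
    by_cases h : i' = i
    · simp [h, Multiset.count_singleton, Fin.ext_iff, eq_comm]
    · simp [h]

theorem sum_card_letterPart {r k : ℕ} (I : Finset (Fin r)) (i : Fin r) (s : Fin k) :
    ∑ i' ∈ I, (letterPart i' (some (i, s))).card = if i ∈ I then 1 else 0 := by
  rw [← Finset.sum_ite_eq I i fun _ => 1]
  refine Finset.sum_congr rfl fun i' _ => ?_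
  simp only [letterPart]
  split_ifs <;> simp

theorem card_rowOf_le_castSucc {r k : ℕ} (i : Fin r) (τ : Option (Fin r × Fin k)) :
    (Finset.univ.filter fun j => rowOf τ j ≤ i.castSucc).card =
      (letterPart i τ).sum + k * ∑ i' ∈ Finset.Iio i, (letterPart i' τ).card := by
  rcases τ with _ | ⟨i', s⟩
  · simp [rowOf, letterPart, (Fin.castSucc_lt_last i).not_ge]
  · rw [sum_card_letterPart]
    simp only [letterPart, Finset.mem_Iio]
    rcases lt_trichotomy i' i with h | rfl | h
    · rw [Finset.filter_true_of_mem, if_neg h.ne, if_pos h]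
      · simp
      · intro j _
        have := Fin.lt_def.1 h
        simp only [rowOf, Fin.le_def]
        split_ifs <;> simp only [Fin.val_castSucc, Fin.val_succ] <;> omega
    · have : (Finset.univ.filter fun j => rowOf (some (i', s)) j ≤ i'.castSucc) =
          Finset.Iic s := by
        ext j
        rw [Finset.mem_filter, Finset.mem_Iic]
        simp only [Finset.mem_univ, true_and, rowOf]
        split_ifs with hj
        · simp [hj]
        · simp [hj, Fin.castSucc_lt_succ.not_ge]
      rw [this]
      simp
    · rw [Finset.filter_false_of_mem, if_neg h.ne', if_neg h.not_gt]
      · simp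
      · intro j _
        have := Fin.lt_def.1 h
        simp only [rowOf, Fin.le_def]
        split_ifs <;> simp only [Fin.val_castSucc, Fin.val_succ] <;> omega

theorem mul_sum_card_letterPart_le {r k : ℕ} (i : Fin r) (τ : Option (Fin r × Fin k)) :
    k * ∑ i' ∈ Finset.Iic i, (letterPart i' τ).card ≤
      (Finset.univ.filter fun j => rowOf τ j ≤ i.succ).card := by
  rcases τ with _ | ⟨i', s⟩
  · simp [letterPart]
  · rw [sum_card_letterPart]
    simp only [Finset.mem_Iic]
    split_ifs with h
    · rw [Finset.filter_true_of_mem]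
      · simp
      · intro j _
        have := Fin.le_def.1 h
        simp only [rowOf, Fin.le_def]
        split_ifs <;> simp only [Fin.val_castSucc, Fin.val_succ] <;> omega
    · simp

/-- The chain of partitions counting the letters of a word. -/
def wordChain {r k M : ℕ} (g : Fin M → Option (Fin r × Fin k)) (i : Fin r) : IntPartition :=
  ⟨(∑ a, letterPart i (g a)).sum, ⟨∑ a, letterPart i (g a), fun {x} hx => by
    obtain ⟨a, -, ha⟩ := Multiset.mem_sum.1 hx
    obtain ⟨s, -, rfl⟩ := mem_letterPart.1 ha
    exact Nat.succ_pos _, rfl⟩⟩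

theorem wordChain_parts {r k M : ℕ} (g : Fin M → Option (Fin r × Fin k)) (i : Fin r) :
    (wordChain g i).2.parts = ∑ a, letterPart i (g a) := rfl

theorem wordChain_le {r k M : ℕ} (g : Fin M → Option (Fin r × Fin k)) (i : Fin r) :
    ∀ x ∈ (wordChain g i).2.parts, x ≤ k := fun x hx => by
  rw [wordChain_parts] at hx
  obtain ⟨a, -, ha⟩ := Multiset.mem_sum.1 hx
  obtain ⟨s, -, rfl⟩ := mem_letterPart.1 ha
  exact s.2

theorem wordChain_size {r k M : ℕ} (g : Fin M → Option (Fin r × Fin k)) (i : Fin r) :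
    (wordChain g i).size = ∑ a, (letterPart i (g a)).sum :=
  Multiset.sum_sum _ _

theorem wordChain_length {r k M : ℕ} (g : Fin M → Option (Fin r × Fin k)) (i : Fin r) :
    (wordChain g i).length = ∑ a, (letterPart i (g a)).card :=
  Multiset.card_sum Finset.univ fun a => letterPart i (g a)

theorem wordChain_freq {r k M : ℕ} (g : Fin M → Option (Fin r × Fin k)) (i : Fin r) (s : Fin k) :
    (wordChain g i).freq (s + 1) = Nat.card {a // g a = some (i, s)} := by
  classical
  rw [IntPartition.freq, wordChain_parts, Multiset.count_sum', Nat.card_eq_fintype_card,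
    Fintype.card_subtype, Finset.card_filter]
  exact Finset.sum_congr rfl fun a _ => count_letterPart i s (g a)

theorem card_filter_prod {M k : ℕ} (p : Fin M → Fin k → Prop) [∀ a j, Decidable (p a j)] :
    (Finset.univ.filter fun q : Fin M × Fin k => p q.1 q.2).card =
      ∑ a, (Finset.univ.filter fun j => p a j).card := by
  simp only [Finset.card_filter]
  exact Fintype.sum_prod_type _

theorem sum_Iic_card_fiber {A : Type*} [Fintype A] {s : ℕ} (w : A → Fin s) (i : Fin s) :
    ∑ j ∈ Finset.Iic i, Nat.card {a // w a = j} = (Finset.univ.filter fun a => w a ≤ i).card := by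
  classical
  rw [Finset.card_eq_sum_card_fiberwise (f := w) (t := Finset.Iic i)
    fun a ha => by simpa using ha]
  refine Finset.sum_congr rfl fun j hj => ?_
  rw [Nat.card_eq_fintype_card, Fintype.card_subtype]
  congr 1
  ext a
  have := Finset.mem_Iic.1 hj
  simp only [Finset.mem_filter, Finset.mem_univ, true_and]
  exact ⟨fun h => ⟨h ▸ this, h⟩, fun h => h.2⟩

theorem Fin.sum_Iic_succ {N : Type*} [AddCommMonoid N] {r : ℕ} (f : Fin (r + 1) → N) (i : Fin r) :
    ∑ j ∈ Finset.Iic i.succ, f j = ∑ j ∈ Finset.Iic i.castSucc, f j + f i.succ := by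
  have : Finset.Iic i.succ = insert i.succ (Finset.Iic i.castSucc) := by
    ext j
    simp only [Finset.mem_Iic, Finset.mem_insert, Fin.le_def, Fin.ext_iff, Fin.val_succ,
      Fin.val_castSucc]
    omega
  rw [this, Finset.sum_insert (by simp), add_comm]

theorem Fin.eq_of_sum_Iic_eq {r : ℕ} {f g : Fin (r + 1) → ℕ}
    (h : ∀ i, ∑ j ∈ Finset.Iic i, f j = ∑ j ∈ Finset.Iic i, g j) (i : Fin (r + 1)) : f i = g i := by
  induction i using Fin.cases with
  | zero =>
    have h0 := h 0
    have : Finset.Iic (0 : Fin (r + 1)) = {0} := by ext; simp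
    rwa [this, Finset.sum_singleton, Finset.sum_singleton] at h0
  | succ i =>
    have h0 := h i.succ
    rw [Fin.sum_Iic_succ, Fin.sum_Iic_succ, h] at h0
    exact Nat.add_left_cancel h0

theorem Fin.sum_Iic_eq_sum_Iio_add {N : Type*} [AddCommMonoid N] {r : ℕ} (f : Fin r → N)
    (i : Fin r) : ∑ j ∈ Finset.Iic i, f j = ∑ j ∈ Finset.Iio i, f j + f i := by
  rw [← Finset.Iio_insert, Finset.sum_insert (by simp), add_comm]

/-- The root chain conditions with subtractions and divisions cleared. -/
theorem isRootChain_iff {r k : ℕ} (hk : 0 < k) (n : Fin (r + 1) → ℕ) (lam : Fin r → IntPartition) :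
    IsRootChain k n lam ↔ ∀ i : Fin r,
      (lam i).size + k * ∑ j ∈ Finset.Iio i, (lam j).length = ∑ j ∈ Finset.Iic i.castSucc, n j ∧
      (∀ a ∈ (lam i).2.parts, a ≤ k) ∧
      k * ∑ j ∈ Finset.Iic i, (lam j).length ≤ ∑ j ∈ Finset.Iic i.succ, n j := by
  refine forall_congr' fun i => ?_
  have hk' : (0 : ℚ) < k := by exact_mod_cast hk
  rw [le_div_iff₀ hk', Fin.sum_Iic_succ, Fin.sum_Iic_eq_sum_Iio_add fun j => (lam j).length]
  have h1 : ((lam i).size : ℤ) = ∑ j ∈ Finset.Iic i.castSucc, (n j : ℤ) -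
      k * ∑ j ∈ Finset.Iio i, ((lam j).length : ℤ) ↔
      (lam i).size + k * ∑ j ∈ Finset.Iio i, (lam j).length = ∑ j ∈ Finset.Iic i.castSucc, n j := by
    zify
    exact eq_sub_iff_add_eq
  rw [h1]
  refine and_congr_right fun h => and_congr_right fun _ => ?_
  rw [← h, ← Nat.cast_add, ← Nat.cast_mul, Nat.cast_le, mul_add, mul_comm (lam i).length]
  omega

theorem isRootChain_wordChain_iff {r k M : ℕ} (hk : 0 < k) (n : Fin (r + 1) → ℕ)
    (hM : ∑ i, n i = M * k) (g : Fin M → Option (Fin r × Fin k)) :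
    IsRootChain k n (wordChain g) ↔
      ∀ i, Nat.card {q : Fin M × Fin k // rowOf (g q.1) q.2 = i} = n i := by
  rw [isRootChain_iff hk]
  have hpre : ∀ i : Fin r, ∑ j ∈ Finset.Iic i.castSucc,
      Nat.card {q : Fin M × Fin k // rowOf (g q.1) q.2 = j} =
        (wordChain g i).size + k * ∑ j ∈ Finset.Iio i, (wordChain g j).length := fun i => by
    rw [sum_Iic_card_fiber, card_filter_prod fun a j => rowOf (g a) j ≤ i.castSucc]
    simp only [card_rowOf_le_castSucc, Finset.sum_add_distrib, wordChain_size, wordChain_length]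
    rw [← Finset.mul_sum, Finset.sum_comm]
  constructor
  · intro h
    refine Fin.eq_of_sum_Iic_eq fun i => ?_
    induction i using Fin.lastCases with
    | cast i => rw [hpre, (h i).1]
    | last =>
      have hu : Finset.Iic (Fin.last r) = Finset.univ := by ext; simp [Fin.le_last]
      rw [sum_Iic_card_fiber, hu, hM, Finset.filter_true_of_mem fun _ _ => Fin.le_last _]
      simp
  · intro h i
    have hf : (fun j => Nat.card {q : Fin M × Fin k // rowOf (g q.1) q.2 = j}) = n := funext h
    refine ⟨by rw [← hpre]; simp only [h], wordChain_le g i, ?_⟩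
    rw [← hf, sum_Iic_card_fiber, card_filter_prod fun a j => rowOf (g a) j ≤ i.succ]
    simp only [wordChain_length]
    rw [Finset.sum_comm, Finset.mul_sum]
    exact Finset.sum_le_sum fun a _ => mul_sum_card_letterPart_le i (g a)

theorem IsRootChain.sum_length_le {r k M : ℕ} (hk : 0 < k) (hr : 1 ≤ r) {n : Fin (r + 1) → ℕ}
    (hM : ∑ i, n i = M * k) {lam : Fin r → IntPartition} (h : IsRootChain k n lam) :
    ∑ i, (lam i).length ≤ M := by
  obtain ⟨r, rfl⟩ := Nat.exists_eq_add_of_le' hr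
  have h1 := ((isRootChain_iff hk n lam).1 h (Fin.last r)).2.2
  have hu : ∀ s : ℕ, Finset.Iic (Fin.last s) = Finset.univ := fun s => by ext; simp [Fin.le_last]
  rw [Fin.succ_last, hu, hu, hM, mul_comm] at h1
  exact Nat.le_of_mul_le_mul_right h1 hk

/-- The letter counts of the words belonging to a chain of partitions. -/
def chainCount {r : ℕ} (k M : ℕ) (lam : Fin r → IntPartition) : Option (Fin r × Fin k) → ℕ
  | none => M - ∑ i, (lam i).length
  | some (i, s) => (lam i).freq (s + 1)

theorem wordChain_eq_iff {r k M : ℕ} {lam : Fin r → IntPartition}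
    (hlam : ∀ i, ∀ a ∈ (lam i).2.parts, a ≤ k) (g : Fin M → Option (Fin r × Fin k)) :
    wordChain g = lam ↔ ∀ τ, Nat.card {a // g a = τ} = chainCount k M lam τ := by
  constructor
  · rintro rfl
    have hs : ∀ i s, Nat.card {a // g a = some (i, s)} = (wordChain g i).freq (s + 1) :=
      fun i s => (wordChain_freq g i s).symm
    rintro (_ | ⟨i, s⟩)
    · have h1 : ∑ τ, Nat.card {a // g a = τ} = M := by
        rw [← Nat.card_sigma, Nat.card_congr (Equiv.sigmaFiberEquiv g), Nat.card_fin]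
      rw [Fintype.sum_option, Fintype.sum_prod_type] at h1
      simp only [hs, IntPartition.sum_freq_eq_length (hlam _)] at h1
      simp only [chainCount]
      omega
    · exact hs i s
  · intro h
    refine funext fun i => IntPartition.ext_parts (Multiset.ext.2 fun a => ?_)
    change (wordChain g i).freq a = (lam i).freq a
    by_cases ha : ∃ s : Fin k, a = s + 1
    · obtain ⟨s, rfl⟩ := ha
      rw [wordChain_freq, h]
      rfl
    · push Not at ha
      rw [IntPartition.freq_eq_zero (wordChain_le g i) ha, IntPartition.freq_eq_zero (hlam i) ha]

theorem card_wordChain_eq_mul {r k M : ℕ} {lam : Fin r → IntPartition}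
    (hlam : ∀ i, ∀ a ∈ (lam i).2.parts, a ≤ k) (hM : ∑ i, (lam i).length ≤ M) :
    Nat.card {g : Fin M → Option (Fin r × Fin k) // wordChain g = lam} *
      ((M - ∑ i, (lam i).length).factorial * ∏ i, (lam i).freqProd) = M.factorial := by
  rw [Nat.card_congr (Equiv.subtypeEquivRight (wordChain_eq_iff hlam)),
    ← card_words_mul_prod_factorial M (chainCount k M lam)]
  · rw [Fintype.prod_option, Fintype.prod_prod_type]
    congr 2
    exact Finset.prod_congr rfl fun i _ => (IntPartition.prod_factorial_freq (hlam i)).symm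
  · rw [Fintype.sum_option, Fintype.sum_prod_type]
    simp only [chainCount, IntPartition.sum_freq_eq_length (hlam _)]
    omega

theorem card_rows_eq_sum {r k M : ℕ} [NeZero k] (n : Fin (r + 1) → ℕ)
    (hM : ∑ i, n i = M * k) :
    Nat.card {w : Fin M × Fin k → Fin (r + 1) //
      (∀ a, IsRow fun j => w (a, j)) ∧ ∀ i, Nat.card {q // w q = i} = n i} =
    ∑ lam ∈ rootChains k n,
      Nat.card {g : Fin M → Option (Fin r × Fin k) // wordChain g = lam} := by
  classical
  have hk := NeZero.pos k
  have e : {g : Fin M → Option (Fin r × Fin k) //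
      ∀ i, Nat.card {q : Fin M × Fin k // rowOf (g q.1) q.2 = i} = n i} ≃
      {w : Fin M × Fin k → Fin (r + 1) //
        (∀ a, IsRow fun j => w (a, j)) ∧ ∀ i, Nat.card {q // w q = i} = n i} := by
    refine Equiv.ofBijective
      (fun g => ⟨fun q => rowOf (g.1 q.1) q.2, fun a => isRow_rowOf (g.1 a), g.2⟩) ⟨fun g g' h => ?_, ?_⟩
    · refine Subtype.ext (funext fun a => rowOf_injective (funext fun j => ?_))
      exact congrFun (congrArg Subtype.val h) (a, j)
    · rintro ⟨w, hw, hw'⟩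
      choose g hg using fun a => (hw a).exists_rowOf
      have hgw : (fun q : Fin M × Fin k => rowOf (g q.1) q.2) = w :=
        funext fun q => congrFun (hg q.1) q.2
      refine ⟨⟨g, fun i => ?_⟩, Subtype.ext hgw⟩
      rw [← hw' i, ← hgw]
  rw [← Nat.card_congr e, Nat.card_eq_fintype_card, Fintype.card_subtype,
    Finset.card_eq_sum_card_fiberwise (f := wordChain) (t := rootChains k n)]
  · refine Finset.sum_congr rfl fun lam hlam => ?_
    rw [Nat.card_eq_fintype_card, Fintype.card_subtype]
    congr 1
    ext g
    simp only [Finset.mem_filter, Finset.mem_univ, true_and]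
    refine ⟨fun h => h.2, fun h => ⟨(isRootChain_wordChain_iff hk n hM g).1 ?_, h⟩⟩
    rw [h]
    exact (mem_rootChains k n lam).1 hlam
  · intro g hg
    have hg' := (Finset.mem_filter.1 hg).2
    exact (mem_rootChains k n _).2 ((isRootChain_wordChain_iff hk n hM g).2 hg')

/-- `m = r + 1 ≥ 2` is the number of path lengths. The path `σ_{ij}` is given by its list of digits
`d i j`, and `i` starts at `0`. In the second part `(∑ i, n i) / k` is an exact quotient, and the
condition on the chains makes it at least `∑ i, ℓ(λ_i)`. -/
theorem theorem3 {X : Type*} [Finite X] (k : ℕ) (hk : 0 < k) (r : ℕ) (hr : 1 ≤ r)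
    (n : Fin (r + 1) → ℕ) (d : (i : Fin (r + 1)) → Fin (n i) → List X)
    (hnodup : ∀ i j, (d i j).Nodup)
    (hdisj : ∀ i j i' j', (⟨i, j⟩ : Σ i, Fin (n i)) ≠ ⟨i', j'⟩ → (d i j).Disjoint (d i' j'))
    (hcover : ∀ x : X, ∃ i j, x ∈ d i j)
    (L : ℕ) (hlen : ∀ i j, (d i j).length + (i : ℕ) = L)
    (htwo : ∀ i j, 2 ≤ (d i j).length)
    (σ : SIM X)
    (hσ : σ = (List.ofFn fun i : Fin (r + 1) =>
      (List.ofFn fun j : Fin (n i) => SIM.path (d i j) (hnodup i j)).prod).prod) :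
    (¬ k ∣ ∑ i, n i → SIM.rootCount k σ = 0) ∧
    (k ∣ ∑ i, n i →
      (SIM.rootCount k σ : ℚ) =
        ∑ lam ∈ rootChains k n,
          ((∏ i, (n i).factorial : ℕ) : ℚ) /
            ((((∑ i, n i) / k - ∑ i, (lam i).length).factorial : ℚ) *
              ((∏ i, (lam i).freqProd : ℕ) : ℚ))) := by
  have : NeZero k := ⟨hk.ne'⟩
  let pt : (Σ i, Fin (n i)) → ℕ → Option X := fun p t => (d p.1 p.2)[t]?
  have hps : PathSystem pt :=
    { inj := fun {p q t u x} h1 h2 => by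
        have hpq : p = q := by
          by_contra hne
          exact hdisj p.1 p.2 q.1 q.2 hne (List.mem_of_getElem? h1) (List.mem_of_getElem? h2)
        subst hpq
        obtain ⟨ht, h1⟩ := List.getElem?_eq_some_iff.1 h1
        obtain ⟨hu, h2⟩ := List.getElem?_eq_some_iff.1 h2
        exact ⟨rfl, ((hnodup p.1 p.2).getElem_inj_iff (hi := ht) (hj := hu)).1 (h1.trans h2.symm)⟩
      surj := fun x => by
        obtain ⟨i, j, hx⟩ := hcover x
        obtain ⟨t, ht⟩ := List.mem_iff_getElem?.1 hx
        exact ⟨⟨i, j⟩, t, ht⟩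
      down := fun {p t} h => List.getElem?_eq_none ((List.getElem?_eq_none_iff.1 h).trans
        (Nat.le_succ t)) }
  have hnone : ∀ p t, pt p t = none ↔ (d p.1 p.2).length ≤ t := fun p t =>
    List.getElem?_eq_none_iff
  have hfol : SIM.Follows σ pt := fun p t x hx => by
    rw [hσ]
    exact SIM.prod_paths_apply d hnodup hdisj hx
  have hP : Nat.card (Σ i, Fin (n i)) = ∑ i, n i := by simp
  constructor
  · intro hdvd
    by_contra h0
    exact hdvd (hP ▸ dvd_of_root hps hnone (fun p => htwo p.1 p.2) hfol h0)
  · rintro ⟨M, hM⟩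
    rw [mul_comm] at hM
    have h1 := rootCount_mul_factorial (c := Sigma.fst) hps hnone (fun p => hlen p.1 p.2)
      (fun p => htwo p.1 p.2) hfol (hP.trans hM)
    have hfib : ∀ i, Nat.card {p : Σ i, Fin (n i) // p.1 = i} = n i := fun i => by
      rw [Nat.card_congr (Equiv.sigmaSubtype i), Nat.card_fin]
    rw [card_equiv_subtype_comp Sigma.fst fun w : Fin M × Fin k → Fin (r + 1) =>
      ∀ a, IsRow fun j => w (a, j)] at h1
    simp only [hfib] at h1
    rw [card_rows_eq_sum n hM] at h1
    have hM0 : (M.factorial : ℚ) ≠ 0 := by exact_mod_cast M.factorial_ne_zero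
    rw [hM, Nat.mul_div_cancel _ hk, ← mul_left_inj' hM0, ← Nat.cast_mul, h1, Nat.cast_mul,
      Nat.cast_sum, Finset.sum_mul, Finset.sum_mul]
    refine Finset.sum_congr rfl fun lam hlam => ?_
    rw [mem_rootChains] at hlam
    have h2 := card_wordChain_eq_mul (k := k) (fun i => (hlam i).2.1)
      (hlam.sum_length_le hk hr hM)
    have h3 : (((M - ∑ i, (lam i).length).factorial : ℚ) *
        ((∏ i, (lam i).freqProd : ℕ) : ℚ)) ≠ 0 := by
      rw [← Nat.cast_mul, Nat.cast_ne_zero]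
      exact right_ne_zero_of_mul (h2.trans_ne M.factorial_ne_zero)
    rw [← h2, div_mul_eq_mul_div, eq_div_iff h3]
    push_cast
    ring
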